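/- Let $G$ be a Hausdorff topological group acting continuously on a compact Hausdorff space $X$ such that every $G$-orbit is dense in $X$ (i.e. $(G,X)$ is minimal), and let $d\ge 1$ and $x\in X$. Write $X^{[d]}=X^{\{0,1\}^d}$ and $G^{[d]}=G^{\{0,1\}^d}$, the latter acting coordinatewise on $X^{[d]}$, and let $x^{[d]}\in X^{[d]}$ be the constant configuration with value $x$. For $F\subset\{0,1\}^d$ and $h\in G$ let $[h]_F\in G^{[d]}$ be equal to $h$ on $F$ and to the identity off $F$. The Host--Kra cube group $\mathcal{HK}^{[d]}\le G^{[d]}$ is generated by all $[h]_F$ with $h\in G$ and $F=\{\omega:\omega_i=a\}$, $1\le i\le d$, $a\in\{0,1\}$; the face group $\mathcal F^{[d]}$ is generated by those with $a=1$. Put $$C_G^{[d]}(X)=\overline{\{g\,y^{[d]}: g\in\mathcal{HK}^{[d]},\ y\in X\}},\quad C_x^{[d]}(X)=\{c\in C_G^{[d]}(X): c(\vec 0)=x\},\quad Y_x^{[d]}(X)=\overline{\mathcal F^{[d]}x^{[d]}} .$$ Let $\pi_*:X^{[d]}\to X^{\{0,1\}^d\setminus\{\vec 0\}}$ forget the $\vec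 0$-coordinate, let $\mathcal F^{[d]}$ act coordinatewise on $X^{\{0,1\}^d\setminus\{\vec 0\}}$, and put $C_{x*}^{[d]}(X)=\pi_*(C_x^{[d]}(X))$, $Y_{x*}^{[d]}(X)=\pi_*(Y_x^{[d]}(X))$. A subsystem of an $\mathcal F^{[d]}$-space is a nonempty closed $\mathcal F^{[d]}$-invariant subset; it is minimal if each of its points has dense orbit in it. Then $C_x^{[d]}(X)$ is nonempty, closed and $\mathcal F^{[d]}$-invariant, and $Y_x^{[d]}(X)$ is the unique minimal subsystem of $(\mathcal F^{[d]},C_x^{[d]}(X))$. Likewise $C_{x*}^{[d]}(X)$ is nonempty, closed and $\mathcal F^{[d]}$-invariant, and $Y_{x*}^{[d]}(X)$ is the unique minimal subsystem of $(\mathcal F^{[d]},C_{x*}^{[d]}(X))$. -/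

import Mathlib

namespace CubeDynamics

universe u v

/-- The discrete cube `{0,1}^d`; its vertex `0` is the constant function `0`. -/
abbrev Cube (d : ℕ) : Type := Fin d → Fin 2

/-- The discrete cube with the vertex `0` removed. -/
abbrev StarCube (d : ℕ) : Type := {ω : Cube d // ω ≠ 0}

/-- The hyperface `{ω | ω i = a}` of the discrete cube; it is upper when `a = 1`. -/
def hyperface {d : ℕ} (i : Fin d) (a : Fin 2) : Set (Cube d) := {ω | ω i = a}

section Groups

variable (d : ℕ) (G : Type u) [Group G]

/-- The Host-Kra cube group: the subgroup of `G^{[d]}` generated by the elements `[h]_F`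
(equal to `h` on `F` and to `1` off `F`), with `F` a hyperface and `h ∈ G`. -/
def hostKraGroup : Subgroup (Cube d → G) :=
  Subgroup.closure
    {γ | ∃ (i : Fin d) (a : Fin 2) (h : G), γ = (hyperface i a).mulIndicator (fun _ => h)}

/-- The face cube group: the subgroup of `G^{[d]}` generated by the elements `[h]_F`
with `F` an upper hyperface and `h ∈ G`. -/
def faceGroup : Subgroup (Cube d → G) :=
  Subgroup.closure
    {γ | ∃ (i : Fin d) (h : G), γ = (hyperface i 1).mulIndicator (fun _ => h)}

end Groups

/-- Restriction of a configuration to the nonzero vertices (forgetting the `0`-coordinate). -/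
def forgetZero {d : ℕ} {X : Type v} (c : Cube d → X) : StarCube d → X := fun ω => c ω.1

/-- The coordinatewise action of the face group on configurations indexed by the nonzero
vertices. (On full configurations the coordinatewise action is Mathlib's `Pi.mulAction'`.) -/
instance starAction (d : ℕ) (G : Type u) [Group G] (X : Type v) [MulAction G X] :
    MulAction (faceGroup d G) (StarCube d → X) where
  smul γ c := fun ω => γ.1 ω.1 • c ω
  one_smul c := funext fun ω => one_smul G (c ω)
  mul_smul γ γ' c := funext fun ω => mul_smul (γ.1 ω.1) (γ'.1 ω.1) (c ω)

section Cubes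

variable (d : ℕ) (G : Type u) [Group G] {X : Type v} [TopologicalSpace X] [MulAction G X]

/-- The constant configuration `x^{[d]}`. -/
def constConfig (x : X) : Cube d → X := fun _ => x

variable (X) in
/-- The dynamical cubes `C_G^{[d]}(X)`: the closure of the set of all `g x^{[d]}` with
`g` in the Host-Kra cube group and `x ∈ X`. -/
def cubes : Set (Cube d → X) :=
  closure {c | ∃ (g : hostKraGroup d G) (x : X), c = g • constConfig d x}

/-- `C_x^{[d]}(X)`: the dynamical cubes whose `0`-vertex is `x`. -/
def cubesAt (x : X) : Set (Cube d → X) := {c | c ∈ cubes d G X ∧ c 0 = x}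

/-- `C_{x*}^{[d]}(X)`: the image of `C_x^{[d]}(X)` after forgetting the `0`-coordinate. -/
def cubesAtStar (x : X) : Set (StarCube d → X) := forgetZero '' cubesAt d G x

/-- `Y_x^{[d]}(X)`: the orbit closure of `x^{[d]}` under the face group. -/
def faceOrbitClosure (x : X) : Set (Cube d → X) :=
  closure (MulAction.orbit (faceGroup d G) (constConfig d x))

/-- `Y_{x*}^{[d]}(X)`: the image of `Y_x^{[d]}(X)` after forgetting the `0`-coordinate. -/
def faceOrbitClosureStar (x : X) : Set (StarCube d → X) :=
  forgetZero '' faceOrbitClosure d G x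

end Cubes

section Subsystems

variable (H : Type u) [Group H] {Z : Type v} [TopologicalSpace Z] [MulAction H Z]

/-- `A` is a (nonempty, closed, invariant) subsystem of the `H`-space `Z`. -/
structure IsSubsystem (A : Set Z) : Prop where
  nonempty : A.Nonempty
  isClosed : IsClosed A
  smul_mem : ∀ (h : H), ∀ z ∈ A, h • z ∈ A

/-- `M` is a minimal subsystem of the system `(H, A)`: a subsystem contained in `A` in which
every orbit is dense. -/
structure IsMinimalSubsystem (A M : Set Z) : Prop where
  isSubsystem : IsSubsystem H M
  subset : M ⊆ A
  orbit_dense : ∀ z ∈ M, M ⊆ closure (MulAction.orbit H z)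

/-- `(H, A)` is a system and `M` is its unique minimal subsystem. -/
structure IsUniqueMinimalSubsystem (A M : Set Z) : Prop where
  system : IsSubsystem H A
  minimal : IsMinimalSubsystem H A M
  unique : ∀ M' : Set Z, IsMinimalSubsystem H A M' → M' = M

end Subsystems

end CubeDynamics

/-!
Up to diagonal translations, which only move the base point, the Host-Kra group is the face group,
so the cubes are the closure of the face group translates of the constant configurations. Every
claim reduces to one: `x^{[d]}` lies in the face group orbit closure of every cube `c` at `x`.

When `X` is second countable, a Baire category argument gives a point `y` at which every cube lies
in the orbit closure of `y^{[d]}`. This passes to all points of `X` through enveloping semigroups: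
compressing the enveloping semigroup of the face group by a minimal idempotent `u` yields a group
acting on the `u`-fixed cubes at a point, and for the good point this action is transitive. That
group is normalized by the diagonal, so transitivity can be conjugated to any other `u`-fixed point,
and inverting the element carrying `x^{[d]}` to `u c` brings the cube `c` back to `x^{[d]}`.

A general `X` is approximated by the factors generated by one continuous function `f : X → ℝ` under
a countable subgroup of `G`, taken closed under countably many choices of group elements so that
the factor is still minimal and the image of `c` is still a cube.
-/

namespace CubeDynamics

open Set Topology

/-- A monoid with a topology in which right multiplications, but not necessarily left ones, are
continuous: the structure carried by enveloping semigroups. -/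
class RightTopologicalMonoid (T : Type*) [Monoid T] [TopologicalSpace T] : Prop where
  continuous_rightMul (q : T) : Continuous (· * q)

open RightTopologicalMonoid

section RightTopologicalMonoid

variable {T : Type*} [Monoid T] [TopologicalSpace T] [RightTopologicalMonoid T]

instance {ι : Type*} : RightTopologicalMonoid (ι → T) where
  continuous_rightMul q :=
    continuous_pi fun i => (continuous_rightMul (q i)).comp (continuous_apply i)

instance (S : Submonoid T) : RightTopologicalMonoid S where
  continuous_rightMul q :=
    ((continuous_rightMul q.1).comp continuous_subtype_val).subtype_mk _

/-- The closure of the image of a monoid acting on `T` by continuous left multiplications: the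
abstract form of an enveloping semigroup. -/
def rangeClosure {H : Type*} [Monoid H] (j : H →* T) (hj : ∀ h, Continuous (j h * ·)) :
    Submonoid T where
  carrier := closure (range j)
  one_mem' := subset_closure ⟨1, map_one j⟩
  mul_mem' := by
    intro p q hp hq
    have range_mul : ∀ γ ∈ range j, γ * q ∈ closure (range j) := by
      rintro _ ⟨h, rfl⟩
      refine map_mem_closure (hj h) hq ?_
      rintro _ ⟨k, rfl⟩
      exact ⟨h * k, map_mul j h k⟩
    simpa only [closure_closure] using map_mem_closure (continuous_rightMul q) hp range_mul

theorem exists_mul_isIdempotentElem [CompactSpace T] [T2Space T] {S : Submonoid T}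
    (hS : IsClosed (S : Set T)) {p : T} (hp : p ∈ S) : ∃ q ∈ S, IsIdempotentElem (q * p) := by
  obtain ⟨_, ⟨q, hq, rfl⟩, hqp⟩ := exists_idempotent_in_compact_subsemigroup continuous_rightMul
    ((· * p) '' S) ⟨_, 1, S.one_mem, rfl⟩ (hS.isCompact.image (continuous_rightMul p)) (by
      rintro _ ⟨a, ha, rfl⟩ _ ⟨b, hb, rfl⟩
      exact ⟨a * p * b, S.mul_mem (S.mul_mem ha hp) hb, mul_assoc _ _ _⟩)
  exact ⟨q, hq, hqp⟩

end RightTopologicalMonoid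

section MinimalLeftIdeals

variable {T : Type*} [Monoid T]

/-- The left ideal `T m` is minimal: `m` belongs to every left ideal contained in it. -/
def IsLeftMinimal (m : T) : Prop := ∀ p, ∃ q, q * (p * m) = m

theorem IsLeftMinimal.mul_left {m : T} (hm : IsLeftMinimal m) (p : T) : IsLeftMinimal (p * m) := by
  intro r
  obtain ⟨q, hq⟩ := hm (r * p)
  exact ⟨p * q, by rw [mul_assoc p, ← mul_assoc r, hq]⟩

theorem exists_isLeftMinimal (T : Type*) [Monoid T] [TopologicalSpace T]
    [RightTopologicalMonoid T] [CompactSpace T] [T2Space T] : ∃ m : T, IsLeftMinimal m := by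
  let closedLeftIdeals : Set (Set T) :=
    {N | IsClosed N ∧ N.Nonempty ∧ ∀ p, ∀ m ∈ N, p * m ∈ N}
  obtain ⟨M, -, hM⟩ : ∃ M, M ⊆ univ ∧ Minimal (· ∈ closedLeftIdeals) M := by
    refine zorn_superset_nonempty closedLeftIdeals (fun c hcI hc hne => ?_) univ
      ⟨isClosed_univ, univ_nonempty, fun _ _ _ => mem_univ _⟩
    refine ⟨⋂₀ c, ⟨isClosed_sInter fun N hN => (hcI hN).1, ?_, fun p m hm => ?_⟩,
      fun N hN => sInter_subset_of_mem hN⟩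
    · have : Nonempty c := hne.coe_sort
      rw [sInter_eq_iInter]
      exact IsCompact.nonempty_iInter_of_directed_nonempty_isCompact_isClosed _
        (DirectedOn.directed_val (IsChain.directedOn hc.symm)) (fun N => (hcI N.2).2.1)
        (fun N => (hcI N.2).1.isCompact) (fun N => (hcI N.2).1)
    · exact mem_sInter.2 fun N hN => (hcI hN).2.2 p m (mem_sInter.1 hm N hN)
  obtain ⟨-, ⟨m, hm⟩, hmul⟩ := hM.prop
  refine ⟨m, fun p => ?_⟩
  have range_mem : range (· * (p * m)) ∈ closedLeftIdeals :=
    ⟨(isCompact_range (continuous_rightMul _)).isClosed, ⟨_, 1, rfl⟩, by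
      rintro q _ ⟨r, rfl⟩
      exact ⟨q * r, mul_assoc _ _ _⟩⟩
  have range_eq : range (· * (p * m)) = M :=
    hM.eq_of_subset range_mem (range_subset_iff.2 fun q => hmul q _ (hmul p m hm))
  exact range_eq.symm.subset hm

/-- A minimal idempotent: an idempotent `u` whose left ideal `T u` is minimal. -/
structure IsMinimalIdempotent (u : T) : Prop where
  isIdempotentElem : IsIdempotentElem u
  isLeftMinimal : IsLeftMinimal u

end MinimalLeftIdeals

section StructureGroup

variable {T : Type*} [Monoid T] {u : T}

/-- The Ellis group `u T u` of a minimal idempotent `u`, described as the set of elements fixed by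
multiplication by `u` on both sides. -/
@[ext]
structure StructureGroup (_ : IsMinimalIdempotent u) where
  val : T
  mul_val : u * val = val
  val_mul : val * u = val

/-- The retraction `p ↦ u p u` onto the structure group. -/
def compress (hu : IsMinimalIdempotent u) (p : T) : StructureGroup hu where
  val := u * p * u
  mul_val := by rw [← mul_assoc, ← mul_assoc, hu.isIdempotentElem]
  val_mul := by rw [mul_assoc, hu.isIdempotentElem]

variable {hu : IsMinimalIdempotent u}

theorem val_compress (p : T) : (compress hu p).val = u * p * u := rfl

namespace StructureGroup

instance : Mul (StructureGroup hu) where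
  mul p q := ⟨p.val * q.val, by rw [← mul_assoc, p.mul_val], by rw [mul_assoc, q.val_mul]⟩

instance : One (StructureGroup hu) where
  one := ⟨u, hu.isIdempotentElem, hu.isIdempotentElem⟩

theorem val_one : (1 : StructureGroup hu).val = u := rfl

theorem val_mul_eq (p q : StructureGroup hu) : (p * q).val = p.val * q.val := rfl

theorem exists_mul_eq_one (p : StructureGroup hu) : ∃ q : StructureGroup hu, q * p = 1 := by
  obtain ⟨q, hq⟩ := hu.isLeftMinimal p.val
  refine ⟨compress hu q, StructureGroup.ext ?_⟩
  calc u * q * u * p.val = u * (q * (p.val * u)) := by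
        rw [mul_assoc, p.mul_val, p.val_mul, mul_assoc]
    _ = u := by rw [hq, hu.isIdempotentElem]

noncomputable instance : Inv (StructureGroup hu) where
  inv p := p.exists_mul_eq_one.choose

noncomputable instance : Group (StructureGroup hu) :=
  Group.ofLeftAxioms (fun _ _ _ => StructureGroup.ext (mul_assoc _ _ _))
    (fun p => StructureGroup.ext p.mul_val) fun p => p.exists_mul_eq_one.choose_spec

end StructureGroup

open StructureGroup

theorem compress_val (p : StructureGroup hu) : compress hu p.val = p :=
  StructureGroup.ext (by rw [val_compress, p.mul_val, p.val_mul])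

theorem compress_one : compress hu 1 = 1 :=
  StructureGroup.ext (by rw [val_compress, mul_one, hu.isIdempotentElem, val_one])

theorem compress_mul_self (p : T) : compress hu (p * u) = compress hu p :=
  StructureGroup.ext (by
    rw [val_compress, val_compress, ← mul_assoc u, mul_assoc (u * p), hu.isIdempotentElem])

theorem compress_mul_compress (p q : T) :
    compress hu p * compress hu q = compress hu (p * u * q) :=
  StructureGroup.ext <| calc
    u * p * u * (u * q * u) = u * p * (u * u) * q * u := by simp only [mul_assoc]
    _ = u * (p * u * q) * u := by rw [hu.isIdempotentElem]; simp only [mul_assoc]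

theorem compress_eq_one {e : T} (he : IsIdempotentElem e) (heu : e * u = e) :
    compress hu e = 1 := by
  have compress_idem : compress hu e * compress hu e = compress hu e := by
    rw [compress_mul_compress, heu, he]
  exact mul_eq_left.1 compress_idem

end StructureGroup

section DiagonalConjugation

variable {d : ℕ} {Q : Type*} [Group Q]

/-- The induction empties `R` one coordinate `i` at a time: on the face `F = {ω | ω i = 1}`
conjugating by the diagonal element `a` is conjugating by `[a]_F`, while off `F` the configuration
`s` agrees with its collapse along `i`. -/
theorem diagonal_conj_mem_of_forall_eq {S : Subgroup (Cube d → Q)} (hzero : ∀ s ∈ S, s 0 = 1)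
    (hface : ∀ (i : Fin d) (a : Q), ((hyperface i 1).mulIndicator fun _ => a) ∈ S)
    (hcollapse : ∀ (i : Fin d), ∀ s ∈ S, (fun ω => s (Function.update ω i 0)) ∈ S)
    (a : Q) (R : Finset (Fin d)) {s : Cube d → Q} (hs : s ∈ S)
    (hR : ∀ ω, s ω = s (fun i => if i ∈ R then ω i else 0)) :
    (fun ω => a * s ω * a⁻¹) ∈ S := by
  induction R using Finset.induction_on generalizing s with
  | empty =>
    have s_eq_one : ∀ ω, s ω = 1 := fun ω => by
      simpa only [Finset.notMem_empty, if_false] using (hR ω).trans (hzero s hs)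
    simp only [s_eq_one, mul_one, mul_inv_cancel]
    exact S.one_mem
  | insert i R hi ih =>
    set s' : Cube d → Q := fun ω => s (Function.update ω i 0) with hs'
    set face : Cube d → Q := (hyperface i 1).mulIndicator fun _ => a with hface'
    have hs'S : s' ∈ S := hcollapse i s hs
    have conj_collapse : (fun ω => a * s' ω * a⁻¹) ∈ S := by
      refine ih hs'S fun ω => ?_
      simp only [hs']
      rw [hR]
      congr 1
      funext j
      by_cases hj : j = i
      · subst hj; simp
      · simp [hj]
    have conj_defect : face * (s'⁻¹ * s) * face⁻¹ ∈ S :=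
      S.mul_mem (S.mul_mem (hface i a) (S.mul_mem (S.inv_mem hs'S) hs)) (S.inv_mem (hface i a))
    convert S.mul_mem conj_collapse conj_defect using 1
    funext ω
    by_cases hω : ω ∈ hyperface i (1 : Fin 2)
    · simp [hface', hω, mul_assoc]
    · have hω0 : ω i = 0 := by
        have : ω i ≠ 1 := hω
        omega
      have hs'ω : s' ω = s ω := by simp only [hs', ← hω0, Function.update_eq_self]
      simp [hface', hω, hs'ω]

theorem diagonal_conj_mem {S : Subgroup (Cube d → Q)} (hzero : ∀ s ∈ S, s 0 = 1)
    (hface : ∀ (i : Fin d) (a : Q), ((hyperface i 1).mulIndicator fun _ => a) ∈ S)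
    (hcollapse : ∀ (i : Fin d), ∀ s ∈ S, (fun ω => s (Function.update ω i 0)) ∈ S)
    (a : Q) {s : Cube d → Q} (hs : s ∈ S) : (fun ω => a * s ω * a⁻¹) ∈ S :=
  diagonal_conj_mem_of_forall_eq hzero hface hcollapse a Finset.univ hs fun ω => by
    simp only [Finset.mem_univ, if_true]

end DiagonalConjugation

section PointwiseTopology

variable {X : Type*} [TopologicalSpace X]

/-- The topology of pointwise convergence on the self-maps of `X`. -/
instance : TopologicalSpace (Function.End X) := inferInstanceAs (TopologicalSpace (X → X))

instance [CompactSpace X] : CompactSpace (Function.End X) :=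
  inferInstanceAs (CompactSpace (X → X))

instance [T2Space X] : T2Space (Function.End X) := inferInstanceAs (T2Space (X → X))

theorem continuous_end_apply (x : X) : Continuous fun p : Function.End X => p x :=
  continuous_apply (A := fun _ : X => X) x

instance : RightTopologicalMonoid (Function.End X) where
  continuous_rightMul q := continuous_pi (A := fun _ : X => X) fun x => continuous_end_apply (q x)

theorem continuous_end_mul {p : Function.End X} (hp : Continuous (p : X → X)) :
    Continuous (p * ·) :=
  continuous_pi (A := fun _ : X => X) fun x => hp.comp (continuous_end_apply x)

end PointwiseTopology

section Envelope

variable (G : Type*) [Monoid G] (X : Type*) [TopologicalSpace X] [MulAction G X]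
  [ContinuousConstSMul G X]

/-- The enveloping (Ellis) semigroup of `(G, X)`: the pointwise closure of the translations of `X`
by the elements of `G`. -/
def envelope : Submonoid (Function.End X) :=
  rangeClosure (MulAction.toEndHom (M := G)) fun g => continuous_end_mul (continuous_const_smul g)

instance [CompactSpace X] : CompactSpace (envelope G X) :=
  isCompact_iff_compactSpace.1 (IsClosed.isCompact isClosed_closure)

/-- The translations by the elements of `G`, as elements of the enveloping semigroup. -/
def toEnvelope : G →* envelope G X :=
  MulAction.toEndHom.codRestrict _ fun g => subset_closure ⟨g, rfl⟩

theorem denseRange_toEnvelope : DenseRange (toEnvelope G X) := fun p => by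
  rw [closure_subtype, ← range_comp]
  exact p.2

theorem continuous_toEnvelope_mul (g : G) : Continuous (toEnvelope G X g * ·) :=
  ((continuous_end_mul (continuous_const_smul g)).comp continuous_subtype_val).subtype_mk _

variable {G X}

theorem toEnvelope_smul (g : G) (x : X) : toEnvelope G X g • x = g • x := rfl

theorem continuous_envelope_smul (x : X) : Continuous fun p : envelope G X => p • x :=
  (continuous_end_apply x).comp continuous_subtype_val

end Envelope

section MinimalEnvelope

variable {G : Type*} [Group G] {X : Type*} [TopologicalSpace X] [CompactSpace X] [T2Space X]
  [MulAction G X] [ContinuousConstSMul G X] [MulAction.IsMinimal G X]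

theorem surjective_envelope_smul (x : X) : Function.Surjective fun p : envelope G X => p • x := by
  rw [← range_eq_univ, ← (isCompact_range (continuous_envelope_smul x)).isClosed.closure_eq]
  refine ((MulAction.dense_orbit G x).mono ?_).closure_eq
  rintro _ ⟨g, rfl⟩
  exact ⟨toEnvelope G X g, toEnvelope_smul g x⟩

theorem exists_isMinimalIdempotent_mul_smul_eq {m : envelope G X} (hm : IsLeftMinimal m) (x : X) :
    ∃ q, IsMinimalIdempotent (q * m) ∧ (q * m) • x = x := by
  obtain ⟨p, hp⟩ := surjective_envelope_smul (G := G) (m • x) x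
  obtain ⟨_, ⟨⟨q, rfl⟩, hqx⟩, idem⟩ := exists_idempotent_in_compact_subsemigroup
    continuous_rightMul (range (· * m) ∩ {r : envelope G X | r • x = x})
    ⟨p * m, ⟨p, rfl⟩, (mul_smul p m x).trans hp⟩
    ((isCompact_range (continuous_rightMul m)).inter_right
      (isClosed_singleton.preimage (continuous_envelope_smul x))) (by
        rintro _ ⟨⟨a, rfl⟩, ha⟩ _ ⟨⟨b, rfl⟩, hb⟩
        exact ⟨⟨a * m * b, mul_assoc _ _ _⟩, by rw [mem_ofPred_eq, mul_smul, hb, ha]⟩)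
  exact ⟨q, ⟨idem, hm.mul_left q⟩, hqx⟩

end MinimalEnvelope

section FaceGroup

variable {d : ℕ} {G : Type*} [Group G]

theorem mulIndicator_mem_faceGroup (i : Fin d) (h : G) :
    ((hyperface i 1).mulIndicator fun _ => h) ∈ faceGroup d G :=
  Subgroup.subset_closure ⟨i, h, rfl⟩

theorem faceGroup_apply_zero {f : Cube d → G} (hf : f ∈ faceGroup d G) : f 0 = 1 := by
  suffices faceGroup d G ≤ (Pi.evalMonoidHom (fun _ : Cube d => G) 0).ker from this hf
  rw [faceGroup, Subgroup.closure_le]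
  rintro _ ⟨i, h, rfl⟩
  change (hyperface i 1).mulIndicator (fun _ => h) 0 = 1
  exact mulIndicator_of_notMem (by simp [hyperface]) _

theorem collapse_mem_faceGroup {f : Cube d → G} (hf : f ∈ faceGroup d G) (i : Fin d) :
    (fun ω => f (Function.update ω i 0)) ∈ faceGroup d G := by
  induction hf using Subgroup.closure_induction with
  | mem f hf =>
    obtain ⟨j, h, rfl⟩ := hf
    by_cases hj : j = i
    · subst hj
      convert one_mem (faceGroup d G) using 1
      funext ω
      exact mulIndicator_of_notMem (by simp [hyperface]) _
    · convert mulIndicator_mem_faceGroup j h using 1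
      funext ω
      by_cases hω : ω j = 1 <;> simp [mulIndicator, hyperface, hj, hω]
  | one => exact one_mem _
  | mul f g _ _ hf hg => exact mul_mem hf hg
  | inv f _ hf => exact inv_mem hf

theorem map_compLeft_faceGroup_le {H : Type*} [Group H] (φ : G →* H) :
    (faceGroup d G).map (φ.compLeft (Cube d)) ≤ faceGroup d H := by
  rw [Subgroup.map_le_iff_le_comap, faceGroup, Subgroup.closure_le]
  rintro _ ⟨i, h, rfl⟩
  have map_indicator : φ.compLeft (Cube d) ((hyperface i 1).mulIndicator fun _ => h) =
      (hyperface i 1).mulIndicator fun _ => φ h := by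
    funext ω
    by_cases hω : ω ∈ hyperface i (1 : Fin 2) <;> simp [hω]
  rw [SetLike.mem_coe, Subgroup.mem_comap, map_indicator]
  exact mulIndicator_mem_faceGroup i (φ h)

theorem diagonal_conj_mem_faceGroup {f : Cube d → G} (hf : f ∈ faceGroup d G) (g : G) :
    (fun ω => g * f ω * g⁻¹) ∈ faceGroup d G :=
  map_compLeft_faceGroup_le (MulAut.conj g).toMonoidHom ⟨f, hf, rfl⟩

end FaceGroup

section FaceEnvelope

variable (d : ℕ) (G : Type*) [Group G] (X : Type*) [TopologicalSpace X] [MulAction G X]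
  [ContinuousConstSMul G X]

/-- The enveloping semigroup of the action of the face group on `X^{[d]}`, realized by
coordinatewise transformations with coordinates in the enveloping semigroup of `(G, X)`. -/
def faceEnvelope : Submonoid (Cube d → envelope G X) :=
  rangeClosure (((toEnvelope G X).compLeft (Cube d)).comp (faceGroup d G).subtype) fun f =>
    continuous_pi fun ω => (continuous_toEnvelope_mul G X (f.1 ω)).comp (continuous_apply ω)

variable {d G X}

theorem isClosed_faceEnvelope : IsClosed (faceEnvelope d G X : Set (Cube d → envelope G X)) :=
  isClosed_closure

theorem faceEnvelope_apply_zero [T2Space X] {φ : Cube d → envelope G X}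
    (hφ : φ ∈ faceEnvelope d G X) : φ 0 = 1 := by
  refine closure_minimal (t := {φ : Cube d → envelope G X | φ 0 = 1}) ?_
    (isClosed_eq (continuous_apply 0) continuous_const) hφ
  rintro _ ⟨f, rfl⟩
  exact (congrArg _ (faceGroup_apply_zero f.2)).trans (map_one (toEnvelope G X))

theorem collapse_mem_faceEnvelope {φ : Cube d → envelope G X} (hφ : φ ∈ faceEnvelope d G X)
    (i : Fin d) : (fun ω => φ (Function.update ω i 0)) ∈ faceEnvelope d G X := by
  refine map_mem_closure (f := fun (φ : Cube d → envelope G X) ω => φ (Function.update ω i 0))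
    (continuous_pi fun ω => continuous_apply _) hφ ?_
  rintro _ ⟨f, rfl⟩
  exact ⟨⟨_, collapse_mem_faceGroup f.2 i⟩, rfl⟩

theorem mulIndicator_mem_faceEnvelope (p : envelope G X) (i : Fin d) :
    ((hyperface i 1).mulIndicator fun _ => p) ∈ faceEnvelope d G X := by
  have continuous_mulIndicator : Continuous fun (p : envelope G X) =>
      (hyperface i (1 : Fin 2)).mulIndicator fun _ => p := by
    refine continuous_pi fun ω => ?_
    by_cases hω : ω ∈ hyperface i (1 : Fin 2)
    · simpa only [mulIndicator_of_mem hω] using continuous_id'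
    · simpa only [mulIndicator_of_notMem hω] using continuous_const
  refine continuous_mulIndicator.closure_preimage_subset _
    (closure_mono ?_ (denseRange_toEnvelope G X p))
  rintro _ ⟨g, rfl⟩
  refine ⟨⟨_, mulIndicator_mem_faceGroup i g⟩, ?_⟩
  funext ω
  by_cases hω : ω ∈ hyperface i (1 : Fin 2) <;> simp [hω]

/-- The configuration equal to the identity at the vertex `0` and to `p` elsewhere. -/
noncomputable def offZero (d : ℕ) {M : Type*} [One M] (p : M) : Cube d → M :=
  ({0}ᶜ : Set (Cube d)).mulIndicator fun _ => p

theorem offZero_zero {M : Type*} [One M] (p : M) : offZero d p 0 = 1 :=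
  mulIndicator_of_notMem (by simp) _

theorem offZero_of_ne {M : Type*} [One M] (p : M) {ω : Cube d} (hω : ω ≠ 0) :
    offZero d p ω = p :=
  mulIndicator_of_mem hω _

theorem compl_zero_eq_biUnion_hyperface :
    ({0}ᶜ : Set (Cube d)) = ⋃ i ∈ Finset.univ, hyperface i 1 := by
  ext ω
  have : (∃ i, ω i = 1) ↔ ω ≠ 0 := by
    rw [Function.ne_iff]
    exact exists_congr fun i => by rw [Pi.zero_apply]; omega
  simpa [hyperface] using this.symm

theorem offZero_mem_faceEnvelope {p : envelope G X} (hp : IsIdempotentElem p) :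
    offZero d p ∈ faceEnvelope d G X := by
  suffices ∀ R : Finset (Fin d),
      ((⋃ i ∈ R, hyperface i 1).mulIndicator fun _ => p) ∈ faceEnvelope d G X by
    simpa only [offZero, compl_zero_eq_biUnion_hyperface] using this Finset.univ
  intro R
  induction R using Finset.induction_on with
  | empty =>
    convert one_mem (faceEnvelope d G X) using 1
    simp [Pi.one_def]
  | insert i R _ ih =>
    convert mul_mem (mulIndicator_mem_faceEnvelope p i) ih using 1
    funext ω
    by_cases hωi : ω ∈ hyperface i (1 : Fin 2) <;>
      by_cases hωR : ω ∈ ⋃ j ∈ R, hyperface j (1 : Fin 2) <;>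
      simp [hωi, hωR, hp.eq]

theorem closure_orbit_faceGroup [CompactSpace X] [T2Space X] (c : Cube d → X) :
    closure (MulAction.orbit (faceGroup d G) c) =
      (· • c) '' (faceEnvelope d G X : Set (Cube d → envelope G X)) := by
  have continuous_smul : Continuous fun φ : Cube d → envelope G X => φ • c :=
    continuous_pi fun ω => (continuous_envelope_smul (c ω)).comp (continuous_apply ω)
  change _ = _ '' closure (range _)
  rw [image_closure_of_isCompact isClosed_closure.isCompact continuous_smul.continuousOn,
    ← range_comp]
  rfl

end FaceEnvelope

section FaceStructureGroup

variable {d : ℕ} {G : Type*} [Group G] {X : Type*} [TopologicalSpace X] [T2Space X]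
  [MulAction G X] [ContinuousConstSMul G X] {u : envelope G X} (hu : IsMinimalIdempotent u)

theorem compress_comp_mul {φ ψ : Cube d → envelope G X} (hφ : φ ∈ faceEnvelope d G X)
    (hψ : ψ ∈ faceEnvelope d G X) :
    (compress hu ∘ φ) * (compress hu ∘ ψ) = compress hu ∘ (φ * offZero d u * ψ) := by
  funext ω
  by_cases hω : ω = 0
  · subst hω
    simp [faceEnvelope_apply_zero hφ, faceEnvelope_apply_zero hψ, offZero_zero, compress_one]
  · simp [compress_mul_compress, offZero_of_ne u hω]

/-- A left inverse of `u φ u` is supplied by any `χ` for which `χ u φ u` is idempotent. -/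
theorem exists_compress_comp_mul_eq_one [CompactSpace X] {φ : Cube d → envelope G X}
    (hφ : φ ∈ faceEnvelope d G X) :
    ∃ χ ∈ faceEnvelope d G X, (compress hu ∘ χ) * (compress hu ∘ φ) = 1 := by
  have hoff := offZero_mem_faceEnvelope (d := d) hu.isIdempotentElem
  obtain ⟨χ, hχ, idem⟩ := exists_mul_isIdempotentElem isClosed_faceEnvelope
    (mul_mem (mul_mem hoff hφ) hoff)
  refine ⟨χ, hχ, ?_⟩
  rw [compress_comp_mul hu hχ hφ]
  funext ω
  by_cases hω : ω = 0
  · subst hω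
    simp [faceEnvelope_apply_zero hφ, faceEnvelope_apply_zero hχ, offZero_zero, compress_one]
  · have idem_apply : IsIdempotentElem (χ ω * u * φ ω * u) := by
      simpa only [IsIdempotentElem, Pi.mul_apply, offZero_of_ne u hω, mul_assoc] using
        congrFun idem ω
    calc compress hu (χ ω * offZero d u ω * φ ω)
        = compress hu (χ ω * u * φ ω * u) := by rw [offZero_of_ne u hω, compress_mul_self]
      _ = 1 := compress_eq_one idem_apply (by rw [mul_assoc _ u, hu.isIdempotentElem])

variable (d) in
/-- The image of the enveloping semigroup of the face group in `(u E u)^{[d]}`, where `E` is the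
enveloping semigroup of `(G, X)`. -/
noncomputable def faceStructureGroup [CompactSpace X] :
    Subgroup (Cube d → StructureGroup hu) where
  carrier := {s | ∃ φ ∈ faceEnvelope d G X, s = compress hu ∘ φ}
  one_mem' := ⟨1, one_mem _, funext fun _ => compress_one.symm⟩
  mul_mem' := by
    rintro _ _ ⟨φ, hφ, rfl⟩ ⟨ψ, hψ, rfl⟩
    exact ⟨_, mul_mem (mul_mem hφ (offZero_mem_faceEnvelope hu.isIdempotentElem)) hψ,
      compress_comp_mul hu hφ hψ⟩
  inv_mem' := by
    rintro _ ⟨φ, hφ, rfl⟩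
    obtain ⟨χ, hχ, hχφ⟩ := exists_compress_comp_mul_eq_one hu hφ
    exact ⟨χ, hχ, inv_eq_of_mul_eq_one_left hχφ⟩

theorem diagonal_conj_mem_faceStructureGroup [CompactSpace X] {s : Cube d → StructureGroup hu}
    (hs : s ∈ faceStructureGroup d hu) (a : StructureGroup hu) :
    (fun ω => a * s ω * a⁻¹) ∈ faceStructureGroup d hu := by
  refine diagonal_conj_mem ?_ (fun i a => ?_) ?_ a hs
  · rintro _ ⟨φ, hφ, rfl⟩
    rw [Function.comp_apply, faceEnvelope_apply_zero hφ, compress_one]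
  · refine ⟨_, mulIndicator_mem_faceEnvelope a.val i, ?_⟩
    funext ω
    by_cases hω : ω ∈ hyperface i (1 : Fin 2) <;> simp [hω, compress_val, compress_one]
  · rintro i _ ⟨φ, hφ, rfl⟩
    exact ⟨_, collapse_mem_faceEnvelope hφ i, rfl⟩

end FaceStructureGroup

section Cubes

variable {d : ℕ} {G : Type*} [Group G]

theorem faceGroup_le_hostKraGroup : faceGroup d G ≤ hostKraGroup d G :=
  Subgroup.closure_mono fun _ ⟨i, h, e⟩ => ⟨i, 1, h, e⟩

theorem exists_faceGroup_mul_diagonal {γ : Cube d → G} (hγ : γ ∈ hostKraGroup d G) :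
    ∃ f ∈ faceGroup d G, ∃ g : G, ∀ ω, γ ω = f ω * g := by
  induction hγ using Subgroup.closure_induction with
  | mem γ hγ =>
    obtain ⟨i, a, h, rfl⟩ := hγ
    obtain rfl | rfl : a = 0 ∨ a = 1 := by omega
    · refine ⟨_, mulIndicator_mem_faceGroup i h⁻¹, h, fun ω => ?_⟩
      obtain hω | hω : ω i = 0 ∨ ω i = 1 := by omega
      all_goals simp [mulIndicator, hyperface, hω]
    · exact ⟨_, mulIndicator_mem_faceGroup i h, 1, fun ω => (mul_one _).symm⟩
  | one => exact ⟨1, one_mem _, 1, fun ω => (mul_one _).symm⟩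
  | mul γ γ' _ _ ih ih' =>
    obtain ⟨f, hf, g, e⟩ := ih
    obtain ⟨f', hf', g', e'⟩ := ih'
    exact ⟨_, mul_mem hf (diagonal_conj_mem_faceGroup hf' g), g * g', fun ω => by
      simp [e, e', mul_assoc]⟩
  | inv γ _ ih =>
    obtain ⟨f, hf, g, e⟩ := ih
    exact ⟨_, diagonal_conj_mem_faceGroup (inv_mem hf) g⁻¹, g⁻¹, fun ω => by simp [e, mul_assoc]⟩

variable {X : Type*} [TopologicalSpace X] [MulAction G X]

theorem constConfig_mem_cubesAt (x : X) : constConfig d x ∈ cubesAt d G x :=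
  ⟨subset_closure ⟨1, x, (one_smul _ _).symm⟩, rfl⟩

variable (d G X) in
theorem cubes_eq_closure_faceGroup_smul :
    cubes d G X = closure {c | ∃ (f : faceGroup d G) (y : X), c = f • constConfig d y} := by
  refine congrArg closure (Subset.antisymm ?_ ?_)
  · rintro _ ⟨⟨γ, hγ⟩, y, rfl⟩
    obtain ⟨f, hf, g, e⟩ := exists_faceGroup_mul_diagonal hγ
    exact ⟨⟨f, hf⟩, g • y, funext fun ω => (congrArg (· • y) (e ω)).trans (mul_smul _ _ _)⟩
  · rintro _ ⟨⟨f, hf⟩, y, rfl⟩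
    exact ⟨⟨f, faceGroup_le_hostKraGroup hf⟩, y, rfl⟩

theorem isClosed_cubesAt [T1Space X] (x : X) : IsClosed (cubesAt d G x) :=
  isClosed_closure.inter (isClosed_singleton.preimage (continuous_apply 0))

variable [ContinuousConstSMul G X]

instance : ContinuousConstSMul (faceGroup d G) (Cube d → X) where
  continuous_const_smul f := continuous_pi fun ω => (continuous_apply ω).const_smul (f.1 ω)

theorem faceGroup_smul_mem_cubesAt {x : X} (f : faceGroup d G) {c : Cube d → X}
    (hc : c ∈ cubesAt d G x) : f • c ∈ cubesAt d G x := by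
  obtain ⟨hc, rfl⟩ := hc
  refine ⟨?_, (congrArg (· • c 0) (faceGroup_apply_zero f.2)).trans (one_smul G _)⟩
  refine map_mem_closure (continuous_const_smul f) hc ?_
  rintro _ ⟨γ, y, rfl⟩
  exact ⟨⟨f, faceGroup_le_hostKraGroup f.2⟩ * γ, y, (mul_smul f.1 γ.1 (constConfig d y)).symm⟩

theorem diagonal_smul_mem_cubes (g : G) {c : Cube d → X} (hc : c ∈ cubes d G X) :
    g • c ∈ cubes d G X := by
  rw [cubes_eq_closure_faceGroup_smul] at hc ⊢
  refine map_mem_closure (continuous_const_smul g) hc ?_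
  rintro _ ⟨f, y, rfl⟩
  refine ⟨⟨_, diagonal_conj_mem_faceGroup f.2 g⟩, g • y, funext fun ω => ?_⟩
  change g • f.1 ω • y = (g * f.1 ω * g⁻¹) • g • y
  rw [smul_smul, smul_smul, inv_mul_cancel_right]

theorem envelope_smul_mem_cubes (p : envelope G X) {c : Cube d → X} (hc : c ∈ cubes d G X) :
    p • c ∈ cubes d G X := by
  have continuous_smul : Continuous fun q : envelope G X => q • c :=
    continuous_pi fun ω => continuous_envelope_smul (c ω)
  refine closure_minimal ?_ (isClosed_closure.preimage continuous_smul)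
    (denseRange_toEnvelope G X p)
  rintro _ ⟨g, rfl⟩
  exact diagonal_smul_mem_cubes g hc

end Cubes

section Orbits

variable {H Z : Type*} [Group H] [TopologicalSpace Z] [MulAction H Z] [ContinuousConstSMul H Z]

theorem smul_mem_closure_orbit (h : H) {y z : Z} (hy : y ∈ closure (MulAction.orbit H z)) :
    h • y ∈ closure (MulAction.orbit H z) := by
  refine map_mem_closure (continuous_const_smul h) hy ?_
  rintro _ ⟨k, rfl⟩
  exact ⟨h * k, mul_smul h k z⟩

theorem closure_orbit_subset {y z : Z} (h : y ∈ closure (MulAction.orbit H z)) :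
    closure (MulAction.orbit H y) ⊆ closure (MulAction.orbit H z) :=
  closure_minimal (range_subset_iff.2 fun k => smul_mem_closure_orbit k h) isClosed_closure

end Orbits

section Generic

variable {d : ℕ} {G : Type*} [Group G] {X : Type*} [TopologicalSpace X] [MulAction G X]

theorem isOpen_setOf_exists_smul_constConfig_mem [ContinuousConstSMul G X] {U : Set (Cube d → X)}
    (hU : IsOpen U) : IsOpen {y : X | ∃ f : faceGroup d G, f • constConfig d y ∈ U} := by
  rw [ofPred_exists]
  exact isOpen_iUnion fun f => hU.preimage (continuous_pi fun ω => continuous_const_smul (f.1 ω))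

theorem mem_closure_setOf_exists_smul_constConfig_mem {x : X} {c : Cube d → X}
    (hc : c ∈ cubesAt d G x) {U : Set (Cube d → X)} (hU : IsOpen U) (hcU : c ∈ U) :
    x ∈ closure {y : X | ∃ f : faceGroup d G, f • constConfig d y ∈ U} := by
  obtain ⟨hc, rfl⟩ := hc
  rw [cubes_eq_closure_faceGroup_smul] at hc
  refine mem_closure_iff.2 fun O hO hcO => ?_
  obtain ⟨_, ⟨hfU, hfO⟩, f, y, rfl⟩ := mem_closure_iff.1 hc (U ∩ (fun b => b 0) ⁻¹' O)
    (hU.inter (hO.preimage (continuous_apply 0))) ⟨hcU, hcO⟩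
  have smul_zero_eq : (f • constConfig d y) 0 = y :=
    (congrArg (· • y) (faceGroup_apply_zero f.2)).trans (one_smul G y)
  exact ⟨y, smul_zero_eq ▸ hfO, f, hfU⟩

variable (d G X) in
theorem eventually_residual_cubesAt_subset [ContinuousConstSMul G X] [SecondCountableTopology X] :
    ∀ᶠ x in residual X, cubesAt d G x ⊆ faceOrbitClosure d G x := by
  let V (U : Set (Cube d → X)) : Set X := {y | ∃ f : faceGroup d G, f • constConfig d y ∈ U}
  have mem_of_mem_closure : ∀ᶠ x in residual X,
      ∀ U ∈ TopologicalSpace.countableBasis (Cube d → X), x ∈ closure (V U) → x ∈ V U := by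
    refine (eventually_countable_ball (TopologicalSpace.countable_countableBasis _)).2
      fun U hU => ?_
    have isOpen_V : IsOpen (V U) := isOpen_setOf_exists_smul_constConfig_mem
      (TopologicalSpace.isOpen_of_mem_countableBasis hU)
    filter_upwards [coborder_mem_residual isOpen_V.isLocallyClosed] with x hx hxV
    exact closure_inter_coborder.subset ⟨hxV, hx⟩
  filter_upwards [mem_of_mem_closure] with x hx c hc
  refine (TopologicalSpace.isBasis_countableBasis _).mem_closure_iff.2 fun U hU hcU => ?_
  obtain ⟨f, hf⟩ := hx U hU (mem_closure_setOf_exists_smul_constConfig_mem hc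
    (TopologicalSpace.isOpen_of_mem_countableBasis hU) hcU)
  exact ⟨_, hf, f, rfl⟩

end Generic

section Transport

variable {d : ℕ} {G : Type*} [Group G] {X : Type*} [TopologicalSpace X] [CompactSpace X] [T2Space X]
  [MulAction G X] [ContinuousConstSMul G X]

theorem smul_mem_closure_orbit_of_mem_faceEnvelope {φ : Cube d → envelope G X}
    (hφ : φ ∈ faceEnvelope d G X) (c : Cube d → X) :
    φ • c ∈ closure (MulAction.orbit (faceGroup d G) c) := by
  rw [closure_orbit_faceGroup]
  exact ⟨φ, hφ, rfl⟩

omit [CompactSpace X] [T2Space X] in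
theorem offZero_smul {u : envelope G X} {c : Cube d → X} (hc : u • c 0 = c 0) :
    offZero d u • c = u • c := by
  funext ω
  by_cases hω : ω = 0
  · subst hω
    rw [Pi.smul_apply', Pi.smul_apply, offZero_zero, one_smul, hc]
  · rw [Pi.smul_apply', Pi.smul_apply, offZero_of_ne u hω]

variable {u : envelope G X} {hu : IsMinimalIdempotent u}

theorem smul_mem_closure_orbit_of_mem_faceStructureGroup {s : Cube d → StructureGroup hu}
    (hs : s ∈ faceStructureGroup d hu) {c : Cube d → X} (hc : u • c = c) :
    (fun ω => (s ω).val • c ω) ∈ closure (MulAction.orbit (faceGroup d G) c) := by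
  obtain ⟨φ, hφ, rfl⟩ := hs
  have hoff := offZero_mem_faceEnvelope (d := d) hu.isIdempotentElem
  have smul_zero_eq : u • c 0 = c 0 := congrFun hc 0
  have smul_eq : (offZero d u * φ * offZero d u) • c = fun ω => (compress hu (φ ω)).val • c ω := by
    have zero_eq : (φ • c) 0 = c 0 := by
      rw [Pi.smul_apply', faceEnvelope_apply_zero hφ, one_smul]
    rw [mul_smul, mul_smul, offZero_smul smul_zero_eq, hc,
      offZero_smul (by rw [zero_eq, smul_zero_eq])]
    funext ω
    rw [val_compress, mul_smul, mul_smul, show u • c ω = c ω from congrFun hc ω]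
    rfl
  exact smul_eq ▸ smul_mem_closure_orbit_of_mem_faceEnvelope (mul_mem (mul_mem hoff hφ) hoff) c

theorem constConfig_mem_closure_orbit_of_forall_exists_faceStructureGroup {x : X} (hux : u • x = x)
    (hx : ∀ b ∈ cubesAt d G x, u • b = b →
      ∃ s ∈ faceStructureGroup d hu, ∀ ω, (s ω).val • x = b ω)
    {c : Cube d → X} (hc : c ∈ cubesAt d G x) :
    constConfig d x ∈ closure (MulAction.orbit (faceGroup d G) c) := by
  have hc0 : u • c 0 = c 0 := by rw [hc.2, hux]
  have u_smul_fixed : u • u • c = u • c := by rw [smul_smul, hu.isIdempotentElem]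
  obtain ⟨s, hs, hsx⟩ := hx (u • c)
    ⟨envelope_smul_mem_cubes u hc.1, hc0.trans hc.2⟩ u_smul_fixed
  have inv_smul_eq : (fun ω => (s⁻¹ ω).val • (u • c) ω) = constConfig d x := by
    funext ω
    rw [← hsx, smul_smul, ← StructureGroup.val_mul_eq, Pi.inv_apply, inv_mul_cancel]
    exact hux
  have u_smul_mem : u • c ∈ closure (MulAction.orbit (faceGroup d G) c) := by
    rw [← offZero_smul hc0]
    exact smul_mem_closure_orbit_of_mem_faceEnvelope
      (offZero_mem_faceEnvelope hu.isIdempotentElem) c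
  rw [← inv_smul_eq]
  exact closure_orbit_subset u_smul_mem
    (smul_mem_closure_orbit_of_mem_faceStructureGroup (inv_mem hs) u_smul_fixed)

theorem exists_faceStructureGroup_of_cubesAt_subset {v : envelope G X} (hv : IsIdempotentElem v)
    (huv : u * v = u) (hvu : v * u = v) {x : X} (hvx : v • x = x)
    (hx : cubesAt d G x ⊆ faceOrbitClosure d G x) {b : Cube d → X}
    (hb : b ∈ cubesAt d G (u • x)) (hub : u • b = b) :
    ∃ s ∈ faceStructureGroup d hu, ∀ ω, (s ω).val • u • x = b ω := by
  have v_smul_mem : v • b ∈ cubesAt d G x :=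
    ⟨envelope_smul_mem_cubes v hb.1, by rw [Pi.smul_apply, hb.2, smul_smul, hvu, hvx]⟩
  obtain ⟨φ, hφ, hφx⟩ := (closure_orbit_faceGroup _).subset (hx v_smul_mem)
  have hφv := mul_mem hφ (offZero_mem_faceEnvelope (d := d) hv)
  refine ⟨_, ⟨_, hφv, rfl⟩, fun ω => ?_⟩
  by_cases hω : ω = 0
  · subst hω
    rw [Function.comp_apply, faceEnvelope_apply_zero hφv, compress_one, hb.2, smul_smul]
    exact congrArg (· • x) hu.isIdempotentElem
  · calc (u * (φ ω * offZero d v ω) * u) • u • x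
        = (u * φ ω * (v * (u * u))) • x := by
          rw [offZero_of_ne v hω, smul_smul]; simp only [mul_assoc]
      _ = u • φ ω • x := by rw [hu.isIdempotentElem, hvu, mul_smul, hvx, mul_smul]
      _ = u • v • b ω := congrArg (u • ·) (congrFun hφx ω)
      _ = b ω := by rw [smul_smul, huv]; exact congrFun hub ω

theorem exists_faceStructureGroup_of_smul_eq {x y : X} (hux : u • x = x) (huy : u • y = y)
    {q : envelope G X} (hqx : q • x = y)
    (hy : ∀ b ∈ cubesAt d G y, u • b = b →
      ∃ s ∈ faceStructureGroup d hu, ∀ ω, (s ω).val • y = b ω)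
    {b : Cube d → X} (hb : b ∈ cubesAt d G x) (hub : u • b = b) :
    ∃ s ∈ faceStructureGroup d hu, ∀ ω, (s ω).val • x = b ω := by
  let a : StructureGroup hu := compress hu q
  have a_smul : a.val • x = y := by
    rw [val_compress, mul_smul, mul_smul, hux, hqx, huy]
  obtain ⟨s, hs, hsy⟩ := hy (a.val • b)
    ⟨envelope_smul_mem_cubes _ hb.1, by rw [Pi.smul_apply, hb.2, a_smul]⟩
    (by rw [smul_smul, a.mul_val])
  refine ⟨_, diagonal_conj_mem_faceStructureGroup hu hs a⁻¹, fun ω => ?_⟩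
  calc (a⁻¹ * s ω * a⁻¹⁻¹).val • x = a⁻¹.val • (s ω).val • a.val • x := by
        rw [inv_inv, StructureGroup.val_mul_eq, StructureGroup.val_mul_eq, mul_smul, mul_smul]
    _ = (a⁻¹ * a).val • b ω := by
        rw [a_smul, hsy, StructureGroup.val_mul_eq, mul_smul, Pi.smul_apply]
    _ = b ω := by rw [inv_mul_cancel]; exact congrFun hub ω

theorem constConfig_mem_closure_orbit_of_cubesAt_subset [MulAction.IsMinimal G X] {y : X}
    (hy : cubesAt d G y ⊆ faceOrbitClosure d G y) {x : X} {c : Cube d → X}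
    (hc : c ∈ cubesAt d G x) : constConfig d x ∈ closure (MulAction.orbit (faceGroup d G) c) := by
  obtain ⟨m, hm⟩ := exists_isLeftMinimal (envelope G X)
  obtain ⟨r, hv, hvy⟩ := exists_isMinimalIdempotent_mul_smul_eq hm y
  set v := r * m
  obtain ⟨q, hu, hux⟩ := exists_isMinimalIdempotent_mul_smul_eq hv.isLeftMinimal x
  set u := q * v with hqv
  -- `u` and `v` generate the same minimal left ideal.
  have huv : u * v = u := by rw [hqv, mul_assoc, hv.isIdempotentElem]
  have hvu : v * u = v := by
    obtain ⟨a, ha⟩ := hv.isLeftMinimal q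
    rw [← ha, mul_assoc, hu.isIdempotentElem]
  obtain ⟨p, hp⟩ := surjective_envelope_smul (G := G) x (u • y)
  refine constConfig_mem_closure_orbit_of_forall_exists_faceStructureGroup (hu := hu) hux
    (fun b hb hub => ?_) hc
  refine exists_faceStructureGroup_of_smul_eq hux ?_ hp (fun b' hb' hub' => ?_) hb hub
  · rw [smul_smul, hu.isIdempotentElem]
  · exact exists_faceStructureGroup_of_cubesAt_subset hv.isIdempotentElem huv hvu hvy hy hb' hub'

theorem constConfig_mem_closure_orbit_of_secondCountable [MulAction.IsMinimal G X]
    [SecondCountableTopology X] {x : X} {c : Cube d → X} (hc : c ∈ cubesAt d G x) :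
    constConfig d x ∈ closure (MulAction.orbit (faceGroup d G) c) := by
  have : Nonempty X := ⟨x⟩
  obtain ⟨y, hy⟩ := (dense_of_mem_residual (eventually_residual_cubesAt_subset d G X)).nonempty
  exact constConfig_mem_closure_orbit_of_cubesAt_subset hy hc

end Transport

section CountableSubgroups

variable {G : Type*} [Group G]

theorem countable_subgroup_closure {s : Set G} (hs : s.Countable) :
    Countable (Subgroup.closure s) := by
  have := hs.to_subtype
  have : Countable (FreeGroup s) := inferInstanceAs (Countable (Quot _))
  have closure_eq : (Subgroup.closure s : Set G) = range (FreeGroup.lift ((↑) : s → G)) := by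
    rw [← MonoidHom.coe_range, FreeGroup.range_lift_eq_closure, Subtype.range_coe]
  exact (closure_eq ▸ countable_range _ : (Subgroup.closure s : Set G).Countable).to_subtype

theorem exists_countable_subgroup_forall_finset_subset {S : Finset G → Set G}
    (hS : ∀ t, (S t).Countable) :
    ∃ K : Subgroup G, Countable K ∧ ∀ t : Finset G, (t : Set G) ⊆ K → S t ⊆ K := by
  let adjoin (K : Subgroup G) : Subgroup G :=
    Subgroup.closure (K ∪ ⋃ t ∈ {t : Finset G | (t : Set G) ⊆ K}, S t)
  let K (n : ℕ) : Subgroup G := adjoin^[n] ⊥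
  have K_succ : ∀ n, K (n + 1) = adjoin (K n) := fun n => Function.iterate_succ_apply' adjoin n ⊥
  have K_directed : Directed (· ≤ ·) K := by
    refine (monotone_nat_of_le_succ fun n => ?_).directed_le
    rw [K_succ]
    exact fun g hg => Subgroup.subset_closure (Or.inl hg)
  have K_countable : ∀ n, Countable (K n) := by
    intro n
    induction n with
    | zero => exact inferInstanceAs (Countable (⊥ : Subgroup G))
    | succ n ih =>
      have countable_finsets : {t : Finset G | (t : Set G) ⊆ K n}.Countable :=
        ((countable_ofPred_finite_subset (K n : Set G).to_countable).preimage
          Finset.coe_injective).mono fun (t : Finset G) ht => And.intro t.finite_toSet ht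
      rw [K_succ]
      exact countable_subgroup_closure
        ((to_countable _).union (countable_finsets.biUnion fun t _ => hS t))
  have coe_iSup : ((⨆ n, K n : Subgroup G) : Set G) = ⋃ n, (K n : Set G) :=
    Subgroup.coe_iSup_of_directed K_directed
  refine ⟨⨆ n, K n, ?_, fun t ht => ?_⟩
  · exact (coe_iSup ▸ countable_iUnion fun n => to_countable (K n : Set G) :
      ((⨆ n, K n : Subgroup G) : Set G).Countable).to_subtype
  · rw [coe_iSup] at ht ⊢
    obtain ⟨n, hn⟩ := Directed.exists_mem_subset_of_finset_subset_biUnion K_directed ht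
    refine subset_iUnion_of_subset (n + 1) ?_
    rw [K_succ]
    exact fun g hg => Subgroup.subset_closure (Or.inr (mem_biUnion hn hg))

theorem exists_finite_forall_mem_map_faceGroup {d : ℕ} {f : Cube d → G} (hf : f ∈ faceGroup d G) :
    ∃ s : Set G, s.Finite ∧ ∀ K : Subgroup G, s ⊆ K →
      f ∈ (faceGroup d K).map (K.subtype.compLeft (Cube d)) := by
  induction hf using Subgroup.closure_induction with
  | mem f hf =>
    obtain ⟨i, h, rfl⟩ := hf
    refine ⟨{h}, finite_singleton h, fun K hK =>
      ⟨_, mulIndicator_mem_faceGroup i ⟨h, hK rfl⟩, funext fun ω => ?_⟩⟩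
    by_cases hω : ω ∈ hyperface i (1 : Fin 2) <;> simp [hω]
  | one => exact ⟨∅, finite_empty, fun K _ => one_mem _⟩
  | mul f f' _ _ ih ih' =>
    obtain ⟨s, hs, mem_map⟩ := ih
    obtain ⟨s', hs', mem_map'⟩ := ih'
    exact ⟨s ∪ s', hs.union hs', fun K hK => mul_mem (mem_map K (subset_union_left.trans hK))
      (mem_map' K (subset_union_right.trans hK))⟩
  | inv f _ ih =>
    obtain ⟨s, hs, mem_map⟩ := ih
    exact ⟨s, hs, fun K hK => inv_mem (mem_map K hK)⟩

end CountableSubgroups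

section CountableApproximation

variable {G : Type*} [Group G] {X : Type*} [TopologicalSpace X] [MulAction G X]
  {Z : Type*} [TopologicalSpace Z]

variable (G) in
theorem exists_countable_forall_mem_closure_image_smul [CompactSpace X] [ContinuousConstSMul G X]
    [MulAction.IsMinimal G X] [SecondCountableTopology Z] {π : X → Z} (hπ : Continuous π) :
    ∃ s : Set G, s.Countable ∧ ∀ x y, π y ∈ closure ((fun g : G => π (g • x)) '' s) := by
  have exists_hitting : ∀ B ∈ TopologicalSpace.countableBasis Z, ∃ s : Set G, s.Countable ∧
      ((π ⁻¹' B).Nonempty → ∀ x, ∃ g ∈ s, π (g • x) ∈ B) := by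
    intro B hB
    by_cases hne : (π ⁻¹' B).Nonempty
    · obtain ⟨I, hI⟩ := isCompact_univ.exists_finite_cover_smul G
        ((TopologicalSpace.isOpen_of_mem_countableBasis hB).preimage hπ) hne
      refine ⟨(·⁻¹) '' I, I.countable_toSet.image _, fun _ x => ?_⟩
      obtain ⟨g, hg, hx⟩ := mem_iUnion₂.1 (hI (mem_univ x))
      exact ⟨g⁻¹, mem_image_of_mem _ hg, mem_smul_set_iff_inv_smul_mem.1 hx⟩
    · exact ⟨∅, countable_empty, fun h => absurd h hne⟩
  choose! s hs hitting using exists_hitting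
  refine ⟨⋃ B ∈ TopologicalSpace.countableBasis Z, s B,
    (TopologicalSpace.countable_countableBasis Z).biUnion hs, fun x y => ?_⟩
  refine (TopologicalSpace.isBasis_countableBasis Z).mem_closure_iff.2 fun B hB hy => ?_
  obtain ⟨g, hg, hgB⟩ := hitting B hB ⟨y, hy⟩ x
  exact ⟨_, hgB, mem_image_of_mem _ (mem_biUnion hB hg)⟩

theorem exists_countable_forall_mem_closure_image_faceGroup [FrechetUrysohnSpace Z] {d : ℕ}
    {c : Cube d → X} (hc : c ∈ cubes d G X) {π : (Cube d → X) → Z} (hπ : Continuous π) :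
    ∃ s : Set G, s.Countable ∧ ∀ K : Subgroup G, s ⊆ K →
      π c ∈ closure (π '' {b | ∃ (f : faceGroup d K) (y : X), b = f • constConfig d y}) := by
  rw [cubes_eq_closure_faceGroup_smul] at hc
  obtain ⟨z, hz, tendsto_z⟩ := mem_closure_iff_seq_limit.1
    (image_closure_subset_closure_image hπ (mem_image_of_mem π hc))
  choose b hb hbz using hz
  choose f y hfy using hb
  choose s hs mem_map using fun n => exists_finite_forall_mem_map_faceGroup (f n).2
  refine ⟨⋃ n, s n, countable_iUnion fun n => (hs n).countable, fun K hK => ?_⟩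
  refine mem_closure_of_tendsto tendsto_z (Filter.Eventually.of_forall fun n => ?_)
  obtain ⟨k, hk, hkf⟩ := mem_map n K ((subset_iUnion s n).trans hK)
  refine ⟨b n, ⟨⟨k, hk⟩, y n, ?_⟩, hbz n⟩
  rw [hfy]
  exact funext fun ω => congrArg (· • y n) (congrFun hkf ω).symm

end CountableApproximation

section OrbitFactor

variable {G : Type*} [Group G] {X : Type*} [MulAction G X] {R : Type*}

/-- The values of `f` at the translates of a point by the elements of `S`. -/
def orbitValues (f : X → R) (S : Set G) (y : X) : S → R := fun g => f (g.1 • y)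

/-- The factor of `(K, X)` generated by the function `f`, on which `K` acts by right translation
of the arguments. -/
abbrev OrbitFactor (f : X → R) (K : Subgroup G) : Type _ := range (orbitValues f (K : Set G))

variable {f : X → R} {K : Subgroup G}

instance : MulAction K (OrbitFactor f K) where
  smul k w := ⟨fun j => w.1 ⟨j.1 * k.1, K.mul_mem j.2 k.2⟩, by
    obtain ⟨_, y, rfl⟩ := w
    exact ⟨k • y, funext fun j => congrArg f (mul_smul j.1 k.1 y).symm⟩⟩
  one_smul w := Subtype.ext (funext fun j => congrArg w.1 (Subtype.ext (mul_one j.1)))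
  mul_smul k l w :=
    Subtype.ext (funext fun j => congrArg w.1 (Subtype.ext (mul_assoc j.1 k.1 l.1).symm))

/-- The factor map onto the factor generated by `f`. -/
def toOrbitFactor (f : X → R) (K : Subgroup G) (y : X) : OrbitFactor f K :=
  rangeFactorization _ y

theorem toOrbitFactor_smul (k : K) (y : X) :
    toOrbitFactor f K (k • y) = k • toOrbitFactor f K y :=
  Subtype.ext (funext fun j => congrArg f (mul_smul j.1 k.1 y).symm)

theorem surjective_toOrbitFactor : Function.Surjective (toOrbitFactor f K) :=
  rangeFactorization_surjective

variable [TopologicalSpace R]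

instance : ContinuousConstSMul K (OrbitFactor f K) where
  continuous_const_smul k := continuous_induced_rng.2 <| continuous_pi fun j =>
    (continuous_apply (⟨j.1 * k.1, K.mul_mem j.2 k.2⟩ : (K : Set G))).comp continuous_subtype_val

theorem orbitValues_mem_closure_image {S : Set G} {A : Set X} {x : X}
    (h : ∀ t : Finset G, (t : Set G) ⊆ S →
      orbitValues f (t : Set G) x ∈ closure (orbitValues f (t : Set G) '' A)) :
    orbitValues f S x ∈ closure (orbitValues f S '' A) := by
  classical
  refine mem_closure_iff.2 fun O hO hxO => ?_
  obtain ⟨I, u, hu, huO⟩ := isOpen_pi_iff.1 hO _ hxO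
  let t : Finset G := I.map (Function.Embedding.subtype _)
  have mem_t : ∀ i : I, i.1.1 ∈ (t : Set G) := fun i => Finset.mem_map_of_mem _ i.2
  have t_subset : (t : Set G) ⊆ S := by
    intro g hg
    obtain ⟨i, -, rfl⟩ := Finset.mem_map.1 hg
    exact i.2
  let U : Set (↥(t : Set G) → R) := ⋂ i : I, {r | r ⟨i.1.1, mem_t i⟩ ∈ u i.1}
  have isOpen_U : IsOpen U := isOpen_iInter_of_finite fun i =>
    (hu i.1 i.2).1.preimage (continuous_apply _)
  obtain ⟨_, hU, a, ha, rfl⟩ := mem_closure_iff.1 (h t t_subset) U isOpen_U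
    (mem_iInter.2 fun i => (hu i.1 i.2).2)
  exact ⟨_, huO fun i hi => mem_iInter.1 hU ⟨i, hi⟩, a, ha, rfl⟩

theorem isMinimal_orbitFactor (h : ∀ t : Finset G, (t : Set G) ⊆ K → ∀ x y,
      orbitValues f (t : Set G) y ∈
        closure ((fun g : G => orbitValues f (t : Set G) (g • x)) '' K)) :
    MulAction.IsMinimal K (OrbitFactor f K) where
  dense_orbit w := by
    obtain ⟨x, rfl⟩ := surjective_toOrbitFactor w
    refine fun w' => ?_
    obtain ⟨y, rfl⟩ := surjective_toOrbitFactor w'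
    have mem_closure := orbitValues_mem_closure_image (A := (· • x) '' (K : Set G)) fun t ht =>
      (image_image _ _ _ ▸ h t ht x y :)
    refine closure_subtype.2 (closure_mono ?_ mem_closure)
    rintro _ ⟨_, ⟨k, hk, rfl⟩, rfl⟩
    exact ⟨_, ⟨⟨k, hk⟩, rfl⟩, congrArg Subtype.val (toOrbitFactor_smul ⟨k, hk⟩ x).symm⟩

theorem isInducing_eval_orbitFactor (ι : Type*) :
    IsInducing fun (b : ι → OrbitFactor f K) (k : (K : Set G)) i => (b i).1 k :=
  ⟨by simp only [Pi.topologicalSpace, instTopologicalSpaceSubtype, induced_iInf, induced_compose,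
      Function.comp_def, iInf_comm (ι := ι)]⟩

theorem toOrbitFactor_comp_mem_cubes {d : ℕ} {c : Cube d → X}
    (h : ∀ t : Finset G, (t : Set G) ⊆ K → orbitValues (f ∘ ·) (t : Set G) c ∈
      closure (orbitValues (f ∘ ·) (t : Set G) ''
        {b | ∃ (k : faceGroup d K) (y : X), b = k • constConfig d y})) :
    toOrbitFactor f K ∘ c ∈ cubes d K (OrbitFactor f K) := by
  rw [cubes_eq_closure_faceGroup_smul,
    (isInducing_eval_orbitFactor (Cube d)).closure_eq_preimage_closure_image]
  refine closure_mono ?_ (orbitValues_mem_closure_image h)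
  rintro _ ⟨_, ⟨k, y, rfl⟩, rfl⟩
  refine ⟨_, ⟨k, toOrbitFactor f K y, rfl⟩, funext fun j => funext fun ω => ?_⟩
  exact congrArg (fun w : OrbitFactor f K => w.1 j) (toOrbitFactor_smul (k.1 ω) y).symm

variable [TopologicalSpace X] [ContinuousConstSMul G X]

theorem continuous_orbitValues (hf : Continuous f) (S : Set G) : Continuous (orbitValues f S) :=
  continuous_pi fun g => hf.comp (continuous_const_smul g.1)

theorem compactSpace_orbitFactor [CompactSpace X] (hf : Continuous f) :
    CompactSpace (OrbitFactor f K) :=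
  isCompact_iff_compactSpace.1 (isCompact_range (continuous_orbitValues hf _))

theorem exists_countable_subgroup_isMinimal_mem_cubes [SecondCountableTopology R] [CompactSpace X]
    [MulAction.IsMinimal G X] (hf : Continuous f) {d : ℕ} {c : Cube d → X}
    (hc : c ∈ cubes d G X) :
    ∃ K : Subgroup G, Countable K ∧ MulAction.IsMinimal K (OrbitFactor f K) ∧
      toOrbitFactor f K ∘ c ∈ cubes d K (OrbitFactor f K) := by
  choose s hs orbit_approx using fun t : Finset G =>
    exists_countable_forall_mem_closure_image_smul G (continuous_orbitValues hf (t : Set G))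
  have continuous_comp : Continuous (f ∘ · : (Cube d → X) → Cube d → R) :=
    continuous_pi fun ω => hf.comp (continuous_apply ω)
  choose s' hs' cube_approx using fun t : Finset G =>
    exists_countable_forall_mem_closure_image_faceGroup hc
      (continuous_orbitValues continuous_comp (t : Set G))
  obtain ⟨K, hK, hsK⟩ :=
    exists_countable_subgroup_forall_finset_subset fun t => (hs t).union (hs' t)
  refine ⟨K, hK, isMinimal_orbitFactor fun t ht x y => ?_,
    toOrbitFactor_comp_mem_cubes fun t ht => ?_⟩
  · exact closure_mono (image_mono (subset_union_left.trans (hsK t ht))) (orbit_approx t x y)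
  · exact cube_approx t K (subset_union_right.trans (hsK t ht))

end OrbitFactor

section Subsystems

variable {d : ℕ} {G X : Type*} [Group G] [TopologicalSpace X] [CompactSpace X] [T2Space X]
  [MulAction G X] [ContinuousConstSMul G X]

omit [MulAction G X] [ContinuousConstSMul G X] in
theorem constConfig_mem_closure_of_forall_continuousMap {x : X} {A : Set (Cube d → X)}
    (h : ∀ f : C(X, ℝ), constConfig d (f x) ∈ closure ((f ∘ ·) '' A)) :
    constConfig d x ∈ closure A := by
  refine mem_closure_iff.2 fun O hO hxO => ?_
  obtain ⟨u, hu, huO⟩ := isOpen_pi_iff'.1 hO _ hxO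
  obtain ⟨f, f_zero, f_one, -⟩ := exists_continuous_zero_one_of_isClosed
    (isClosed_singleton (x := x)) (isOpen_iInter_of_finite fun ω => (hu ω).1).isClosed_compl
    (disjoint_singleton_left.2 fun hx => hx (mem_iInter.2 fun ω => (hu ω).2))
  obtain ⟨_, lt_one, a, ha, rfl⟩ := mem_closure_iff.1 (h f) (univ.pi fun _ => Iio 1)
    (isOpen_set_pi finite_univ fun _ _ => isOpen_Iio)
    (fun _ _ => (f_zero rfl).trans_lt zero_lt_one)
  refine ⟨a, huO fun ω _ => ?_, ha⟩
  by_contra hω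
  exact (lt_one ω trivial).ne (f_one fun h => hω (mem_iInter.1 h ω))

theorem constConfig_mem_closure_orbit [MulAction.IsMinimal G X] {x : X} {c : Cube d → X}
    (hc : c ∈ cubesAt d G x) : constConfig d x ∈ closure (MulAction.orbit (faceGroup d G) c) := by
  refine constConfig_mem_closure_of_forall_continuousMap fun f => ?_
  obtain ⟨K, _, _, hcK⟩ := exists_countable_subgroup_isMinimal_mem_cubes f.continuous hc.1
  have := compactSpace_orbitFactor (K := K) f.continuous
  have mem_closure := constConfig_mem_closure_orbit_of_secondCountable
    (x := toOrbitFactor f K x) ⟨hcK, congrArg _ hc.2⟩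
  let evalOne (w : OrbitFactor f K) : ℝ := w.1 ⟨1, one_mem K⟩
  have evalOne_toOrbitFactor (y : X) : evalOne (toOrbitFactor f K y) = f y :=
    congrArg f (one_smul G y)
  have continuous_evalOne : Continuous (evalOne ∘ · : (Cube d → OrbitFactor f K) → Cube d → ℝ) :=
    continuous_pi fun ω => (continuous_apply (⟨1, one_mem K⟩ : (K : Set G))).comp
      (continuous_subtype_val.comp (continuous_apply ω))
  have comp_constConfig :
      evalOne ∘ constConfig d (toOrbitFactor f K x) = constConfig d (f x) :=
    funext fun _ => evalOne_toOrbitFactor x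
  rw [← comp_constConfig]
  refine map_mem_closure continuous_evalOne mem_closure ?_
  rintro _ ⟨φ, rfl⟩
  refine ⟨_, ⟨⟨_, map_compLeft_faceGroup_le K.subtype ⟨_, φ.2, rfl⟩⟩, rfl⟩, funext fun ω => ?_⟩
  exact (evalOne_toOrbitFactor _).symm.trans (congrArg evalOne (toOrbitFactor_smul (φ.1 ω) (c ω)))

end Subsystems

section UniqueMinimalSubsystem

variable {H Z : Type*} [Group H] [TopologicalSpace Z] [MulAction H Z]

theorem IsSubsystem.closure_orbit_subset {A : Set Z} (hA : IsSubsystem H A) {z : Z} (hz : z ∈ A) :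
    closure (MulAction.orbit H z) ⊆ A :=
  closure_minimal (range_subset_iff.2 fun h => hA.smul_mem h z hz) hA.isClosed

theorem isSubsystem_closure_orbit [ContinuousConstSMul H Z] (a : Z) :
    IsSubsystem H (closure (MulAction.orbit H a)) where
  nonempty := ⟨a, subset_closure (MulAction.mem_orbit_self a)⟩
  isClosed := isClosed_closure
  smul_mem h _ hz := smul_mem_closure_orbit h hz

theorem isUniqueMinimalSubsystem_closure_orbit [ContinuousConstSMul H Z] {A : Set Z}
    (hA : IsSubsystem H A) {a : Z} (ha : a ∈ A)
    (h : ∀ z ∈ A, a ∈ closure (MulAction.orbit H z)) :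
    IsUniqueMinimalSubsystem H A (closure (MulAction.orbit H a)) where
  system := hA
  minimal :=
    { isSubsystem := isSubsystem_closure_orbit a
      subset := hA.closure_orbit_subset ha
      orbit_dense := fun z hz => closure_orbit_subset (h z (hA.closure_orbit_subset ha hz)) }
  unique M hM := by
    obtain ⟨m, hm⟩ := hM.isSubsystem.nonempty
    have a_mem : a ∈ M := hM.isSubsystem.closure_orbit_subset hm (h m (hM.subset hm))
    exact (hM.orbit_dense a a_mem).antisymm (hM.isSubsystem.closure_orbit_subset a_mem)

variable {W : Type*} [TopologicalSpace W] [MulAction H W] {π : Z → W}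

theorem IsSubsystem.image {A : Set Z} (hA : IsSubsystem H A) (hπ : IsClosedMap π)
    (map_smul : ∀ (h : H) z, π (h • z) = h • π z) : IsSubsystem H (π '' A) where
  nonempty := hA.nonempty.image π
  isClosed := hπ A hA.isClosed
  smul_mem := by
    rintro h _ ⟨z, hz, rfl⟩
    exact ⟨h • z, hA.smul_mem h z hz, map_smul h z⟩

theorem image_closure_orbit (hπ : IsClosedMap π) (continuous_π : Continuous π)
    (map_smul : ∀ (h : H) z, π (h • z) = h • π z) (z : Z) :
    π '' closure (MulAction.orbit H z) = closure (MulAction.orbit H (π z)) := by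
  rw [← hπ.closure_image_eq_of_continuous continuous_π, MulAction.orbit, ← range_comp]
  exact congrArg (closure ∘ range) (funext fun h => map_smul h z)

theorem isUniqueMinimalSubsystem_image_closure_orbit [ContinuousConstSMul H W] {A : Set Z}
    (hA : IsSubsystem H A) {a : Z} (ha : a ∈ A) (h : ∀ z ∈ A, a ∈ closure (MulAction.orbit H z))
    (hπ : IsClosedMap π) (continuous_π : Continuous π)
    (map_smul : ∀ (h : H) z, π (h • z) = h • π z) :
    IsUniqueMinimalSubsystem H (π '' A) (π '' closure (MulAction.orbit H a)) := by
  rw [image_closure_orbit hπ continuous_π map_smul]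
  refine isUniqueMinimalSubsystem_closure_orbit (hA.image hπ map_smul) ⟨a, ha, rfl⟩ ?_
  rintro _ ⟨z, hz, rfl⟩
  rw [← image_closure_orbit hπ continuous_π map_smul]
  exact mem_image_of_mem π (h z hz)

end UniqueMinimalSubsystem

section Cubes

variable {d : ℕ} {G X : Type*} [Group G] [TopologicalSpace X] [MulAction G X]

theorem continuous_forgetZero : Continuous (forgetZero : (Cube d → X) → StarCube d → X) :=
  continuous_pi fun ω => continuous_apply ω.1

variable [ContinuousConstSMul G X]

instance : ContinuousConstSMul (faceGroup d G) (StarCube d → X) where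
  continuous_const_smul f := continuous_pi fun ω => (continuous_apply ω).const_smul (f.1 ω.1)

theorem isSubsystem_cubesAt [T1Space X] (x : X) :
    IsSubsystem (faceGroup d G) (cubesAt d G x) where
  nonempty := ⟨_, constConfig_mem_cubesAt x⟩
  isClosed := isClosed_cubesAt x
  smul_mem f _ hc := faceGroup_smul_mem_cubesAt f hc

end Cubes

end CubeDynamics

theorem mainTheorem3_general {G : Type*} [Group G] {X : Type*} [TopologicalSpace X]
    [CompactSpace X] [T2Space X] [MulAction G X] [ContinuousConstSMul G X]
    [MulAction.IsMinimal G X] (d : ℕ) (x : X) :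
    CubeDynamics.IsUniqueMinimalSubsystem (CubeDynamics.faceGroup d G)
        (CubeDynamics.cubesAt d G x) (CubeDynamics.faceOrbitClosure d G x) ∧
      CubeDynamics.IsUniqueMinimalSubsystem (CubeDynamics.faceGroup d G)
        (CubeDynamics.cubesAtStar d G x) (CubeDynamics.faceOrbitClosureStar d G x) := by
  open CubeDynamics in
  have isSubsystem := isSubsystem_cubesAt (d := d) (G := G) x
  have mem_closure_orbit : ∀ c ∈ cubesAt d G x,
      constConfig d x ∈ closure (MulAction.orbit (faceGroup d G) c) :=
    fun _ => constConfig_mem_closure_orbit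
  exact ⟨isUniqueMinimalSubsystem_closure_orbit isSubsystem (constConfig_mem_cubesAt x)
      mem_closure_orbit,
    isUniqueMinimalSubsystem_image_closure_orbit isSubsystem (constConfig_mem_cubesAt x)
      mem_closure_orbit continuous_forgetZero.isClosedMap continuous_forgetZero fun _ _ => rfl⟩

theorem mainTheorem3 {G : Type*} [Group G] [TopologicalSpace G] [IsTopologicalGroup G] [T2Space G]
    {X : Type*} [TopologicalSpace X] [CompactSpace X] [T2Space X]
    [MulAction G X] [ContinuousSMul G X] [MulAction.IsMinimal G X]
    (d : ℕ) (hd : 1 ≤ d) (x : X) :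
    CubeDynamics.IsUniqueMinimalSubsystem (CubeDynamics.faceGroup d G)
        (CubeDynamics.cubesAt d G x) (CubeDynamics.faceOrbitClosure d G x) ∧
      CubeDynamics.IsUniqueMinimalSubsystem (CubeDynamics.faceGroup d G)
        (CubeDynamics.cubesAtStar d G x) (CubeDynamics.faceOrbitClosureStar d G x) :=
  mainTheorem3_general d x
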